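/- A permutation $\pi$ is a pattern of $\sigma$ if some subsequence of $\sigma$ has the same order type as $\pi$; $S_n(321)$ is the set of permutations of length $n$ that do not have $321$ as a pattern; a permutation $\mu$ is an $S_n(321)$-superpattern if every $\sigma\in S_n(321)$ is a pattern of $\mu$. The columns of a permutation $\sigma$ are its maximal ascending runs, numbered from left to right, and its rows are the sets of values that form the maximal ascending runs of $\sigma^{-1}$, numbered by increasing value. The chessboard representation of $\sigma$ is the matrix whose $(i,j)$ entry is the number of elements of $\sigma$ in row $i$ and column $j$. For $n\ge 0$ put $s=\lceil\sqrt n\,\rceil$ and $N=6n+8s$, and let $M_n$ be the $N\times N$ zero-one matrix with $[M_n]_{i,j}=1$ exactly when $0\le i-j\le 2s+1$, or $j-i=ks$ for some integer $k$ with $0\le k\le\lfloor N/s\rfloor$ (for $n=0$ the matrix is empty). **Theorem.** For every $n$ there is exactly one permutation $\mu_n$ whose chessboard representation is $M_n$. Both $\mu_n$ and its inverse $\mu_n^{-1}$ (the permutation obtained by exchanging the roles of rows and columns) are $S_n(321)$-superpatterns. The length of $\mu_n$ is $30n^{3/2}+\Theta(n)$, that is, there are constants $c,C>0$ and $n_0$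 such that $c\,n\le|\mu_n|-30n^{3/2}\le C\,n$ for all $n\ge n_0$. -/

import Mathlib

namespace Superpattern

open Equiv

/-- `π` is a pattern of `σ`: some subsequence of `σ` has the same order type as `π`.
The elements of `S_n` are the permutations of `Fin n` (positions and values numbered from `0`). -/
def IsPattern {k m : ℕ} (π : Perm (Fin k)) (σ : Perm (Fin m)) : Prop :=
  ∃ l : Fin k → Fin m, StrictMono l ∧ ∀ i j, π i < π j ↔ σ (l i) < σ (l j)

/-- The permutation `321`. -/
def perm321 : Perm (Fin 3) := Fin.revPerm

/-- `S_n(π)`: the permutations of length `n` that avoid `π`. -/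
def avoiders (n : ℕ) {k : ℕ} (π : Perm (Fin k)) : Set (Perm (Fin n)) :=
  {σ | ¬ IsPattern π σ}

/-- `μ` is a `P`-superpattern: every member of `P` is a pattern of `μ`. -/
def IsSuperpattern {m n : ℕ} (μ : Perm (Fin m)) (P : Set (Perm (Fin n))) : Prop :=
  ∀ σ ∈ P, IsPattern σ μ

/-- The index (from `0`, left to right) of the maximal ascending run of `σ` that contains the
position `p`: every descent at or before `p` starts a new run. -/
def runIndex {m : ℕ} (σ : Perm (Fin m)) (p : Fin m) : ℕ :=
  (Finset.univ.filter fun r : Fin m =>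
    r ≤ p ∧ ∃ q : Fin m, (q : ℕ) + 1 = (r : ℕ) ∧ σ r < σ q).card

/-- The number of maximal ascending runs of `σ`. -/
def numRuns {m : ℕ} (σ : Perm (Fin m)) : ℕ :=
  (Finset.univ.image (runIndex σ)).card

/-- `M` is the chessboard representation of `σ`. The columns of `σ` are its maximal ascending runs,
numbered from left to right; the rows are the sets of values that form the maximal ascending runs of
`σ⁻¹`, numbered by increasing value. `M i j` is the number of elements of `σ` in row `i` and
column `j`. -/
def IsChessboard {m r c : ℕ} (σ : Perm (Fin m)) (M : Matrix (Fin r) (Fin c) ℕ) : Prop :=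
  numRuns σ⁻¹ = r ∧ numRuns σ = c ∧
    ∀ i j, M i j = (Finset.univ.filter fun p : Fin m =>
      runIndex σ⁻¹ (σ p) = (i : ℕ) ∧ runIndex σ p = (j : ℕ)).card

/-- `⌈√n⌉`. -/
noncomputable def ceilSqrt (n : ℕ) : ℕ := ⌈Real.sqrt (n : ℝ)⌉₊

/-- The side length `6n + 8⌈√n⌉`. -/
noncomputable def side (n : ℕ) : ℕ := 6 * n + 8 * ceilSqrt n

open Classical in
/-- The zero-one matrix `M_n`: the band of entries at or below the diagonal at distance at most
`2⌈√n⌉ + 1` from it, and the diagonal lines (the diagonal itself and every `⌈√n⌉`-th one above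
it). -/
noncomputable def boardMatrix (n : ℕ) : Matrix (Fin (side n)) (Fin (side n)) ℕ := fun i j =>
  if (0 ≤ (i : ℤ) - (j : ℤ) ∧ (i : ℤ) - (j : ℤ) ≤ 2 * (ceilSqrt n : ℤ) + 1) ∨
      (∃ k : ℕ, k ≤ side n / ceilSqrt n ∧ (j : ℤ) - (i : ℤ) = (k : ℤ) * (ceilSqrt n : ℤ))
    then 1 else 0

end Superpattern

/-!
A permutation with distinct cells on its chessboard is read off these cells in two orders: column by
column for the positions, row by row for the values. Any set of cells thus determines a permutation,
whose runs are the columns as soon as consecutive columns always force a descent, and placing `σ` on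
cells of the board of `μ` makes `σ` a pattern of `μ`.

A permutation `σ` avoiding `321` is the union of its left-to-right maxima and of the increasing
sequence of the remaining, lower elements. Let `A` be the largest value and `B` the largest lower
value up to a given position. The element at this position is placed in block
`2 (⌊A / s⌋ + ⌊B / s⌋)` of `s` consecutive columns, and in a block of rows computed in a similar way
from quantities that depend on its value only. For a left-to-right maximum the row exceeds the
column by less than `2 s`, so the cell lies in the band. For a lower element the two offsets within
the blocks agree and the block of the row is at most that of the column, so the cell lies on a line.

Column `j` of the board contains `min (N - j) (2 s + 2)` cells of the band and `⌊j / s⌋` further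
cells on the lines; their sum over all columns is the length.
-/

namespace Superpattern

open Equiv Finset Function

theorem covBy_induction {α : Type*} [Preorder α] [PredOrder α] [WellFoundedLT α] {P : α → Prop}
    (isMin : ∀ a, IsMin a → P a) (covBy : ∀ a b, a ⋖ b → P a → P b) (a : α) : P a := by
  induction a using WellFoundedLT.induction with
  | ind a ih =>
    by_cases ha : IsMin a
    · exact isMin a ha
    · have hpred := Order.pred_covBy_of_not_isMin ha
      exact covBy _ a hpred (ih _ hpred.lt)

theorem covBy_of_monotone_of_surjective {α β : Type*} [LinearOrder α] [Preorder β] {f : α → β}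
    (hf : Monotone f) (hsurj : Surjective f) {a b : α} (hab : a ⋖ b) (hlt : f a < f b) :
    f a ⋖ f b := by
  refine ⟨hlt, fun c hac hcb => ?_⟩
  obtain ⟨t, rfl⟩ := hsurj c
  exact hab.2 (hf.reflect_lt hac) (hf.reflect_lt hcb)

section Runs

variable {m : ℕ} {σ : Perm (Fin m)}

theorem runIndex_mono (σ : Perm (Fin m)) : Monotone (runIndex σ) := fun _ _ hpq =>
  card_le_card <| monotone_filter_right _ fun _ _ hr => ⟨hr.1.trans hpq, hr.2⟩

theorem runIndex_of_isMin {p : Fin m} (hp : IsMin p) : runIndex σ p = 0 := by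
  refine card_eq_zero.2 (filter_eq_empty_iff.2 ?_)
  rintro r - ⟨hr, q, hq, -⟩
  have hrq : r ≤ q := (hp.mono hr) (Fin.le_def.2 (by omega))
  omega

theorem runIndex_of_covBy {q r : Fin m} (hqr : q ⋖ r) :
    runIndex σ r = runIndex σ q + if σ r < σ q then 1 else 0 := by
  have hval : (q : ℕ) + 1 = r := Nat.covBy_iff_add_one_eq.1 (Fin.covBy_iff.1 hqr)
  have hdescent : (∃ q' : Fin m, (q' : ℕ) + 1 = r ∧ σ r < σ q') ↔ σ r < σ q :=
    ⟨fun ⟨q', hq', h⟩ => by rwa [show q = q' from Fin.ext (by omega)], fun h => ⟨q, hval, h⟩⟩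
  have hIic : Iic r = insert r (Iic q) := by
    ext t
    simp only [mem_insert, mem_Iic, Fin.le_def, Fin.ext_iff]
    omega
  have hnot : r ∉ Iic q := by simpa using hqr.lt
  simp only [runIndex, ← filter_filter, filter_ge_eq_Iic, card_filter]
  rw [hIic, sum_insert hnot, add_comm]
  simp only [hdescent]

theorem eq_runIndex {f : Fin m → ℕ} (h0 : ∀ p, IsMin p → f p = 0)
    (hstep : ∀ q r, q ⋖ r → f r = f q + if σ r < σ q then 1 else 0) : f = runIndex σ := by
  funext p
  induction p using covBy_induction with
  | isMin p hp => rw [h0 p hp, runIndex_of_isMin hp]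
  | covBy q r hqr ih => rw [hstep q r hqr, runIndex_of_covBy hqr, ih]

theorem lt_of_runIndex_eq {p q : Fin m} (hpq : p < q) (h : runIndex σ p = runIndex σ q) :
    σ p < σ q := by
  induction q using covBy_induction with
  | isMin q hq => exact absurd hpq hq.not_lt
  | covBy q r hqr ih =>
    have hpq' : p ≤ q := hqr.le_of_lt hpq
    have hstep := runIndex_of_covBy (σ := σ) hqr
    have hmono := runIndex_mono σ hpq'
    have hnot : ¬ σ r < σ q := fun hd => by rw [if_pos hd] at hstep; omega
    have hasc : σ q < σ r := (not_lt.1 hnot).lt_of_ne (σ.injective.ne hqr.lt.ne)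
    rw [if_neg hnot, add_zero] at hstep
    rcases hpq'.eq_or_lt with rfl | hlt
    · exact hasc
    · exact (ih hlt (h.trans hstep)).trans hasc

theorem exists_runIndex_eq {p : Fin m} {k : ℕ} (hk : k ≤ runIndex σ p) :
    ∃ q, runIndex σ q = k := by
  induction p using covBy_induction with
  | isMin p hp => exact ⟨p, by rw [runIndex_of_isMin hp] at hk ⊢; omega⟩
  | covBy q r hqr ih =>
    rcases hk.eq_or_lt with rfl | hlt
    · exact ⟨r, rfl⟩
    · refine ih ?_
      rw [runIndex_of_covBy hqr] at hlt
      split_ifs at hlt <;> omega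

theorem runIndex_lt_numRuns (p : Fin m) : runIndex σ p < numRuns σ := by
  have hsub : range (runIndex σ p + 1) ⊆ univ.image (runIndex σ) := fun k hk => by
    obtain ⟨q, hq⟩ := exists_runIndex_eq (mem_range_succ_iff.1 hk)
    exact mem_image.2 ⟨q, mem_univ q, hq⟩
  exact (card_range _).ge.trans (card_le_card hsub)

end Runs

section Placement

variable {k m : ℕ} {R C : Type*} [LinearOrder R] [LinearOrder C]

/-- `σ` is the permutation formed by distinct cells of a chessboard, where `cell p` is the cell
`(row, column)` of the element at position `p`: positions increase column by column and, within a
column, row by row, while values increase row by row and, within a row, column by column. -/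
structure IsPlacement (σ : Perm (Fin m)) (cell : Fin m → R × C) : Prop where
  strictMono_position : StrictMono fun p => toLex (cell p).swap
  strictMono_value : StrictMono fun v => toLex (cell (σ⁻¹ v))

namespace IsPlacement

variable {σ : Perm (Fin m)} {μ : Perm (Fin k)} {cell : Fin m → R × C} {cell' : Fin k → R × C}

theorem lt_iff (hσ : IsPlacement σ cell) {p q : Fin m} :
    p < q ↔ toLex (cell p).swap < toLex (cell q).swap :=
  hσ.strictMono_position.lt_iff_lt.symm

theorem apply_lt_apply_iff (hσ : IsPlacement σ cell) {p q : Fin m} :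
    σ p < σ q ↔ toLex (cell p) < toLex (cell q) := by
  simpa using (hσ.strictMono_value.lt_iff_lt (a := σ p) (b := σ q)).symm

theorem injective (hσ : IsPlacement σ cell) : Injective cell := fun _ _ h =>
  hσ.strictMono_position.injective (congrArg (fun x => toLex x.swap) h)

theorem inv (hσ : IsPlacement σ cell) : IsPlacement σ⁻¹ fun v => (cell (σ⁻¹ v)).swap where
  strictMono_position := hσ.strictMono_value
  strictMono_value := by simpa using hσ.strictMono_position

theorem map_iff {R' C' : Type*} [LinearOrder R'] [LinearOrder C'] {f : R → R'} {g : C → C'}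
    (hf : StrictMono f) (hg : StrictMono g) :
    IsPlacement σ (fun p => (cell p).map f g) ↔ IsPlacement σ cell := by
  have hlex (x y : R × C) : toLex (x.map f g) < toLex (y.map f g) ↔ toLex x < toLex y := by
    simp only [Prod.Lex.toLex_lt_toLex, Prod.map, hf.lt_iff_lt, hg.lt_iff_lt, hf.injective.eq_iff]
  have hlex' (x y : R × C) :
      toLex (x.map f g).swap < toLex (y.map f g).swap ↔ toLex x.swap < toLex y.swap := by
    simp only [Prod.Lex.toLex_lt_toLex, Prod.map, Prod.swap, hf.lt_iff_lt, hg.lt_iff_lt,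
      hg.injective.eq_iff]
  constructor <;> rintro ⟨hpos, hval⟩ <;> constructor
  · simpa only [StrictMono, hlex'] using hpos
  · simpa only [StrictMono, hlex] using hval
  · simpa only [StrictMono, hlex'] using hpos
  · simpa only [StrictMono, hlex] using hval

theorem isPattern (hσ : IsPlacement σ cell) (hμ : IsPlacement μ cell')
    (hcell : Set.range cell ⊆ Set.range cell') : IsPattern σ μ := by
  choose l hl using fun p => hcell (Set.mem_range_self p)
  refine ⟨l, fun p q hpq => ?_, fun p q => ?_⟩
  · rwa [hμ.lt_iff, hl, hl, ← hσ.lt_iff]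
  · rw [hσ.apply_lt_apply_iff, hμ.apply_lt_apply_iff, hl, hl]

theorem card_eq (hσ : IsPlacement σ cell) {S : Finset (R × C)} (hS : Set.range cell = S) :
    #S = m := by
  have himage : univ.image cell = S := by rw [← coe_inj, coe_image, coe_univ, Set.image_univ, hS]
  rw [← himage, card_image_of_injective _ hσ.injective, card_univ, Fintype.card_fin]

theorem eq_of_range_eq {τ : Perm (Fin m)} {cell' : Fin m → R × C} (hσ : IsPlacement σ cell)
    (hτ : IsPlacement τ cell') (hcell : Set.range cell = Set.range cell') : σ = τ := by
  have hpos : cell = cell' := by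
    have h := (hσ.strictMono_position.range_inj hτ.strictMono_position).1 (by
      simpa only [← Set.range_comp, comp_def] using
        congrArg (Set.image fun x => toLex x.swap) hcell)
    funext p
    simpa using congrFun h p
  subst hpos
  have hval := (hσ.strictMono_value.range_inj hτ.strictMono_value).1 <|
    ((Equiv.surjective σ⁻¹).range_comp fun p => toLex (cell p)).trans
      ((Equiv.surjective τ⁻¹).range_comp fun p => toLex (cell p)).symm
  refine inv_injective (Equiv.ext fun v => hσ.injective ?_)
  exact toLex.injective (congrFun hval v)

end IsPlacement

theorem exists_equiv_strictMono {α β : Type*} [LinearOrder β] (S : Finset α) {key : α → β}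
    (hkey : Injective key) : ∃ e : Fin #S ≃ S, StrictMono fun p => key (e p) := by
  let e := S.equivFin.symm
  refine ⟨(Tuple.sort fun p => key (e p)).trans e, ?_⟩
  refine (Tuple.monotone_sort fun p => key (e p)).strictMono_of_injective ?_
  exact (hkey.comp (Subtype.val_injective.comp e.injective)).comp (Equiv.injective _)

theorem exists_isPlacement (S : Finset (R × C)) :
    ∃ (σ : Perm (Fin #S)) (cell : Fin #S → R × C), IsPlacement σ cell ∧ Set.range cell = S := by
  obtain ⟨pos, hpos⟩ := exists_equiv_strictMono S (toLex.injective.comp Prod.swap_injective)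
  obtain ⟨val, hval⟩ := exists_equiv_strictMono S toLex.injective
  exact ⟨pos.trans val.symm, fun p => pos p, ⟨hpos, by simpa using hval⟩,
    (pos.surjective.range_comp Subtype.val).trans Subtype.range_coe⟩

end Placement

section Chessboard

variable {m r c : ℕ} {R C : Type*}

/-- The zero-one matrix whose ones are the cells of `S`. -/
def cellMatrix (S : Finset (Fin r × Fin c)) : Matrix (Fin r) (Fin c) ℕ :=
  Matrix.of fun i j => if (i, j) ∈ S then 1 else 0

/-- The pair `(row, column)` of run indices of the element at position `p`. -/
def runCell (σ : Perm (Fin m)) (p : Fin m) : ℕ × ℕ :=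
  (runIndex σ⁻¹ (σ p), runIndex σ p)

theorem strictMono_swap_runCell {σ : Perm (Fin m)} (hσ : Injective (runCell σ)) :
    StrictMono fun p => toLex (runCell σ p).swap := by
  intro p q hpq
  rw [Prod.Lex.toLex_lt_toLex]
  rcases (runIndex_mono σ hpq.le).lt_or_eq with hcol | hcol
  · exact Or.inl hcol
  · have hrow := runIndex_mono σ⁻¹ (lt_of_runIndex_eq hpq hcol).le
    exact Or.inr ⟨hcol, hrow.lt_of_ne fun h => hpq.ne (hσ (Prod.ext h hcol))⟩

theorem runCell_inv (σ : Perm (Fin m)) (v : Fin m) :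
    runCell σ⁻¹ v = (runCell σ (σ⁻¹ v)).swap := by
  simp [runCell]

theorem isPlacement_runCell {σ : Perm (Fin m)} (hσ : Injective (runCell σ)) :
    IsPlacement σ (runCell σ) where
  strictMono_position := strictMono_swap_runCell hσ
  strictMono_value := by
    have hinv : Injective (runCell σ⁻¹) := by
      rw [funext (runCell_inv σ)]
      exact Prod.swap_injective.comp (hσ.comp σ⁻¹.injective)
    simpa only [runCell_inv, Prod.swap_swap] using strictMono_swap_runCell hinv

theorem IsChessboard.exists_isPlacement {σ : Perm (Fin m)} {S : Finset (Fin r × Fin c)}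
    (h : IsChessboard σ (cellMatrix S)) :
    ∃ cell : Fin m → Fin r × Fin c, IsPlacement σ cell ∧ Set.range cell = S := by
  let cell (p : Fin m) : Fin r × Fin c :=
    (⟨runIndex σ⁻¹ (σ p), h.1 ▸ runIndex_lt_numRuns _⟩,
      ⟨runIndex σ p, h.2.1 ▸ runIndex_lt_numRuns p⟩)
  have hcard (x : Fin r × Fin c) : (if x ∈ S then 1 else 0) = #{p | cell p = x} := by
    simpa only [cellMatrix, Matrix.of_apply, cell, Prod.ext_iff, Fin.ext_iff] using
      h.2.2 x.1 x.2
  have hinj : Injective cell := by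
    intro p q hpq
    have hle : #{t | cell t = cell q} ≤ 1 := by
      rw [← hcard]
      split_ifs <;> omega
    exact card_le_one.1 hle p (by simpa using hpq) q (by simp)
  have hval : (fun p => (cell p).map Fin.val Fin.val) = runCell σ := rfl
  refine ⟨cell, ?_, Set.ext fun x => ?_⟩
  · rw [← IsPlacement.map_iff Fin.val_strictMono Fin.val_strictMono, hval]
    exact isPlacement_runCell
      (hval ▸ (Fin.val_injective.prodMap Fin.val_injective).comp hinj)
  · have hmem : x ∈ S ↔ 0 < #{p | cell p = x} := by
      rw [← hcard]
      split_ifs <;> simpa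
    simp [hmem, card_pos, filter_nonempty_iff]

/-- No column of `S` is empty and every two consecutive columns contain cells in descending rows;
this is what makes the columns of a placement on `S` its maximal ascending runs. -/
def ColumnsAreRuns [LT R] [LT C] (S : Set (R × C)) : Prop :=
  (∀ j, ∃ i, (i, j) ∈ S) ∧
    ∀ ⦃j j'⦄, j ⋖ j' → ∃ i i', (i, j) ∈ S ∧ (i', j') ∈ S ∧ i' < i

theorem ColumnsAreRuns.surjective_snd [LT R] [LT C] {cell : Fin m → R × C}
    (hcols : ColumnsAreRuns (Set.range cell)) : Surjective fun p => (cell p).2 := fun j => by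
  obtain ⟨i, p, hp⟩ := hcols.1 j
  exact ⟨p, congrArg Prod.snd hp⟩

namespace IsPlacement

variable [LinearOrder R] {σ : Perm (Fin m)}

section

variable [LinearOrder C] {cell : Fin m → R × C}

theorem monotone_column (hσ : IsPlacement σ cell) : Monotone fun p => (cell p).2 :=
  Prod.Lex.monotone_fst_ofLex.comp hσ.strictMono_position.monotone

theorem row_le_of_column_eq (hσ : IsPlacement σ cell) {p q : Fin m} (hpq : p ≤ q)
    (hcol : (cell p).2 = (cell q).2) : (cell p).1 ≤ (cell q).1 := by
  have hlex := hσ.strictMono_position.monotone hpq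
  simp only [Prod.Lex.toLex_le_toLex, Prod.fst_swap, Prod.snd_swap, hcol, lt_irrefl, false_or,
    true_and] at hlex
  exact hlex

theorem apply_lt_apply_of_covBy (hσ : IsPlacement σ cell)
    (hcols : ColumnsAreRuns (Set.range cell)) {q r : Fin m} (hqr : q ⋖ r)
    (hcol : (cell q).2 < (cell r).2) : σ r < σ q := by
  have hcov := covBy_of_monotone_of_surjective hσ.monotone_column hcols.surjective_snd hqr hcol
  obtain ⟨i, i', ⟨a, ha⟩, ⟨b, hb⟩, hi⟩ := hcols.2 hcov
  have haq : a ≤ q := hqr.le_of_lt (hσ.monotone_column.reflect_lt (by simpa [ha] using hcol))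
  have hrb : r ≤ b := hqr.ge_of_gt (hσ.monotone_column.reflect_lt (by simpa [hb] using hcol))
  have hrow_q : i ≤ (cell q).1 := by simpa [ha] using hσ.row_le_of_column_eq haq (by rw [ha])
  have hrow_r : (cell r).1 ≤ i' := by simpa [hb] using hσ.row_le_of_column_eq hrb (by rw [hb])
  rw [hσ.apply_lt_apply_iff, Prod.Lex.toLex_lt_toLex]
  exact Or.inl (hrow_r.trans_lt (hi.trans_le hrow_q))

end

variable {cell : Fin m → R × Fin c}

theorem column_eq_runIndex (hσ : IsPlacement σ cell) (hcols : ColumnsAreRuns (Set.range cell)) :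
    (fun p => ((cell p).2 : ℕ)) = runIndex σ := by
  refine eq_runIndex (fun p hp => ?_) fun q r hqr => ?_
  · obtain ⟨p₀, hp₀⟩ := hcols.surjective_snd ⟨0, (cell p).2.pos⟩
    have hle := hσ.monotone_column (hp.isBot p₀)
    exact Nat.le_zero.1 (hle.trans hp₀.le)
  · rcases Prod.Lex.toLex_lt_toLex.1 (hσ.lt_iff.1 hqr.lt) with hcol | ⟨hcol, hrow⟩
    · have hcov := covBy_of_monotone_of_surjective hσ.monotone_column hcols.surjective_snd
        hqr hcol
      rw [if_pos (hσ.apply_lt_apply_of_covBy hcols hqr hcol)]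
      exact (Nat.covBy_iff_add_one_eq.1 (Fin.covBy_iff.1 hcov)).symm
    · have hasc : σ q < σ r :=
        hσ.apply_lt_apply_iff.2 (Prod.Lex.toLex_lt_toLex.2 (Or.inl hrow))
      rw [if_neg hasc.asymm, add_zero]
      exact congrArg Fin.val hcol.symm

theorem numRuns_eq (hσ : IsPlacement σ cell) (hcols : ColumnsAreRuns (Set.range cell)) :
    numRuns σ = c := by
  have himage : univ.image (fun p => ((cell p).2 : ℕ)) = univ.image (Fin.val : Fin c → ℕ) := by
    rw [← image_univ_of_surjective hcols.surjective_snd, image_image]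
    rfl
  rw [numRuns, ← hσ.column_eq_runIndex hcols, himage,
    card_image_of_injective _ Fin.val_injective, card_univ, Fintype.card_fin]

theorem isChessboard {cell : Fin m → Fin r × Fin c} (hσ : IsPlacement σ cell)
    {S : Finset (Fin r × Fin c)} (hS : Set.range cell = S)
    (hcols : ColumnsAreRuns (S : Set (Fin r × Fin c)))
    (hrows : ColumnsAreRuns (Prod.swap ⁻¹' (S : Set (Fin r × Fin c)))) :
    IsChessboard σ (cellMatrix S) := by
  have hrange : Set.range (fun v => (cell (σ⁻¹ v)).swap) = Prod.swap ⁻¹' (S : Set _) := by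
    rw [← hS, ← Set.image_swap_eq_preimage_swap, ← Set.range_comp]
    exact (Equiv.surjective σ⁻¹).range_comp (Prod.swap ∘ cell)
  rw [← hS] at hcols
  rw [← hrange] at hrows
  refine ⟨hσ.inv.numRuns_eq hrows, hσ.numRuns_eq hcols, fun i j => ?_⟩
  have hcell (p : Fin m) : (runIndex σ⁻¹ (σ p) = i ∧ runIndex σ p = j) ↔ cell p = (i, j) := by
    rw [← hσ.column_eq_runIndex hcols, ← hσ.inv.column_eq_runIndex hrows]
    simp [Prod.ext_iff, Fin.ext_iff]
  simp only [hcell]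
  by_cases hij : (i, j) ∈ S
  · obtain ⟨p, hp⟩ : (i, j) ∈ Set.range cell := hS ▸ hij
    rw [cellMatrix, Matrix.of_apply, if_pos hij, eq_comm, card_eq_one]
    refine ⟨p, ext fun q => ?_⟩
    simp [← hp, hσ.injective.eq_iff]
  · rw [cellMatrix, Matrix.of_apply, if_neg hij, eq_comm, card_eq_zero, filter_eq_empty_iff]
    exact fun p _ hp => hij (by rw [← mem_coe, ← hS]; exact ⟨p, hp⟩)

end IsPlacement

theorem existsUnique_isChessboard {S : Finset (Fin r × Fin c)}
    (hcols : ColumnsAreRuns (S : Set (Fin r × Fin c)))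
    (hrows : ColumnsAreRuns (Prod.swap ⁻¹' (S : Set (Fin r × Fin c)))) :
    ∃! μ : (Σ m : ℕ, Perm (Fin m)), IsChessboard μ.2 (cellMatrix S) := by
  obtain ⟨σ, cell, hσ, hS⟩ := exists_isPlacement S
  refine ⟨⟨#S, σ⟩, hσ.isChessboard hS hcols hrows, fun ⟨m, τ⟩ hτ => ?_⟩
  obtain ⟨cell', hτ', hS'⟩ := hτ.exists_isPlacement
  obtain rfl := hτ'.card_eq hS'
  exact congrArg (Sigma.mk _) (hτ'.eq_of_range_eq hσ (hS'.trans hS.symm))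

theorem IsChessboard.card_eq {σ : Perm (Fin m)} {S : Finset (Fin r × Fin c)}
    (h : IsChessboard σ (cellMatrix S)) : #S = m := by
  obtain ⟨cell, hσ, hS⟩ := h.exists_isPlacement
  exact hσ.card_eq hS

end Chessboard

section Inverse

open scoped Pointwise

variable {k m n : ℕ}

theorem IsPattern.inv {π : Perm (Fin k)} {μ : Perm (Fin m)} (h : IsPattern π μ) :
    IsPattern π⁻¹ μ⁻¹ := by
  obtain ⟨l, hl, hiff⟩ := h
  refine ⟨fun v => μ (l (π⁻¹ v)), fun v w hvw => ?_, fun v w => ?_⟩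
  · simpa [← hiff] using hvw
  · simp [hl.lt_iff_lt]

theorem inv_avoiders (n : ℕ) (π : Perm (Fin k)) : (avoiders n π)⁻¹ = avoiders n π⁻¹ := by
  ext σ
  exact not_congr ⟨fun h => by simpa using h.inv, IsPattern.inv⟩

theorem IsSuperpattern.inv {μ : Perm (Fin m)} {P : Set (Perm (Fin n))} (h : IsSuperpattern μ P) :
    IsSuperpattern μ⁻¹ P⁻¹ := fun σ hσ => by
  simpa using (h σ⁻¹ hσ).inv

theorem perm321_inv : perm321⁻¹ = perm321 := rfl

end Inverse

section LeftToRightMaxima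

variable {n : ℕ} {σ : Perm (Fin n)} {p q : Fin n}

/-- The element at position `p` is a lower element of `σ`: it is not a left-to-right maximum. -/
def IsLower (σ : Perm (Fin n)) (p : Fin n) : Prop :=
  ∃ q < p, σ p < σ q

instance (σ : Perm (Fin n)) : DecidablePred (IsLower σ) := fun p =>
  inferInstanceAs (Decidable (∃ q < p, σ p < σ q))

theorem lt_of_not_isLower (hp : ¬ IsLower σ p) (hqp : q < p) : σ q < σ p :=
  (not_lt.1 fun h => hp ⟨q, hqp, h⟩).lt_of_ne (σ.injective.ne hqp.ne)

theorem isPattern_perm321 {a b c : Fin n} (hab : a < b) (hbc : b < c) (hba : σ b < σ a)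
    (hcb : σ c < σ b) : IsPattern perm321 σ := by
  have hca := hcb.trans hba
  refine ⟨![a, b, c], ?_, ?_⟩
  · intro i j hij
    fin_cases i <;> fin_cases j <;> first | exact absurd hij (by decide) | simp [*, hab.trans hbc]
  · intro i j
    rw [perm321, Fin.revPerm_apply, Fin.revPerm_apply, Fin.rev_lt_rev]
    fin_cases i <;> fin_cases j <;> simp [hba, hcb, hca, hba.le, hcb.le, hca.le]

theorem strictMonoOn_isLower (hσ : σ ∈ avoiders n perm321) :
    StrictMonoOn σ {p | IsLower σ p} := by
  rintro p ⟨t, htp, ht⟩ q - hpq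
  refine (not_lt.1 fun h => hσ ?_).lt_of_ne (σ.injective.ne hpq.ne)
  exact isPattern_perm321 htp hpq ht h

/-- The largest value of `σ` at a position in `P`. Values are counted from `1`, so that the result
is `0` exactly when `P` is empty. -/
def maxValue (σ : Perm (Fin n)) (P : Finset (Fin n)) : ℕ :=
  P.sup fun q => (σ q : ℕ) + 1

/-- The largest value up to position `p`. -/
def runMax (σ : Perm (Fin n)) (p : Fin n) : ℕ :=
  maxValue σ (Iic p)

/-- The largest value of a lower element up to position `p`. -/
def lowMax (σ : Perm (Fin n)) (p : Fin n) : ℕ :=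
  maxValue σ {q ∈ Iic p | IsLower σ q}

/-- The largest value of a lower element such that all values up to its position are less than
`v`. -/
def lowBelow (σ : Perm (Fin n)) (v : ℕ) : ℕ :=
  maxValue σ {q | IsLower σ q ∧ runMax σ q < v}

theorem maxValue_mono (σ : Perm (Fin n)) : Monotone (maxValue σ) := fun _ _ h => sup_mono h

theorem maxValue_le_length (P : Finset (Fin n)) : maxValue σ P ≤ n :=
  Finset.sup_le fun q _ => (σ q).2

theorem le_runMax (p : Fin n) : (σ p : ℕ) + 1 ≤ runMax σ p :=
  le_sup (f := fun q => (σ q : ℕ) + 1) (mem_Iic.2 le_rfl)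

theorem runMax_mono (σ : Perm (Fin n)) : Monotone (runMax σ) := fun _ _ h =>
  maxValue_mono σ (Iic_subset_Iic.2 h)

theorem lowMax_mono (σ : Perm (Fin n)) : Monotone (lowMax σ) := fun _ _ h =>
  maxValue_mono σ (filter_subset_filter _ (Iic_subset_Iic.2 h))

theorem lowBelow_mono (σ : Perm (Fin n)) : Monotone (lowBelow σ) := fun _ _ h =>
  maxValue_mono σ (monotone_filter_right _ fun _ _ hq => ⟨hq.1, hq.2.trans_le h⟩)

theorem lowMax_le_runMax (p : Fin n) : lowMax σ p ≤ runMax σ p :=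
  maxValue_mono σ (filter_subset _ _)

theorem lowBelow_le (v : ℕ) : lowBelow σ v ≤ v := by
  rw [lowBelow, maxValue, Finset.sup_le_iff]
  intro q hq
  rw [mem_filter_univ] at hq
  exact (le_runMax q).trans hq.2.le

theorem lowMax_eq (hσ : σ ∈ avoiders n perm321) (hp : IsLower σ p) : lowMax σ p = σ p + 1 := by
  refine le_antisymm (Finset.sup_le fun q hq => ?_)
    (le_sup (f := fun q => (σ q : ℕ) + 1) (mem_filter.2 ⟨mem_Iic.2 le_rfl, hp⟩))
  obtain ⟨hqp, hq⟩ := mem_filter.1 hq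
  exact Nat.succ_le_succ ((strictMonoOn_isLower hσ).monotoneOn hq hp (mem_Iic.1 hqp))

theorem lowMax_lt (hσ : σ ∈ avoiders n perm321) (hpq : p < q) (hq : IsLower σ q) :
    lowMax σ p < lowMax σ q := by
  rw [lowMax_eq hσ hq, lowMax, maxValue, Finset.sup_lt_iff (Nat.succ_pos _)]
  intro t ht
  obtain ⟨htp, ht⟩ := mem_filter.1 ht
  exact Nat.succ_lt_succ (strictMonoOn_isLower hσ ht hq ((mem_Iic.1 htp).trans_lt hpq))

theorem runMax_eq (hp : ¬ IsLower σ p) : runMax σ p = σ p + 1 := by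
  refine le_antisymm (Finset.sup_le fun q hq => Nat.succ_le_succ ?_) (le_runMax p)
  rcases (mem_Iic.1 hq).eq_or_lt with rfl | hqp
  · exact le_rfl
  · exact (lt_of_not_isLower hp hqp).le

theorem lowBelow_eq (hp : ¬ IsLower σ p) : lowBelow σ (σ p + 1) = lowMax σ p := by
  rw [lowBelow, lowMax, ← runMax_eq hp]
  congr 1
  ext q
  rw [mem_filter_univ, mem_filter, mem_Iic, and_comm]
  refine and_congr_left fun hq => ⟨fun hlt => ((runMax_mono σ).reflect_lt hlt).le,
    fun hqp => ?_⟩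
  have hlt : q < p := hqp.lt_of_ne fun h => hp (h ▸ hq)
  rw [runMax_eq hp, runMax, maxValue, Finset.sup_lt_iff (Nat.succ_pos _)]
  exact fun t ht => Nat.succ_lt_succ (lt_of_not_isLower hp ((mem_Iic.1 ht).trans_lt hlt))

end LeftToRightMaxima

section Embedding

variable {n s : ℕ} {σ : Perm (Fin n)}

theorem mod_lt_mod_of_div_eq {a b : ℕ} (hab : a < b) (hdiv : a / s = b / s) : a % s < b % s := by
  have ha := Nat.div_add_mod a s
  have hb := Nat.div_add_mod b s
  rw [hdiv] at ha
  omega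

/-- The residue of `a` modulo `s`, placed in the `k`-th block of `s` consecutive numbers. -/
def blockPos (s k a : ℕ) : ℕ :=
  k * s + a % s

theorem blockPos_lt_blockPos {k l : ℕ} (hs : 0 < s) (hkl : k < l) (a b : ℕ) :
    blockPos s k a < blockPos s l b := by
  have ha := Nat.mod_lt a hs
  have hmul : (k + 1) * s ≤ l * s := Nat.mul_le_mul_right s hkl
  rw [add_one_mul] at hmul
  unfold blockPos
  omega

theorem blockPos_lt_of_le {k c : ℕ} (hs : 0 < s) (hk : k ≤ c * (n / s)) (a : ℕ) :
    blockPos s k a < c * n + s := by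
  have ha := Nat.mod_lt a hs
  have hmul : k * s ≤ c * n :=
    calc k * s ≤ c * (n / s) * s := Nat.mul_le_mul_right s hk
      _ = c * (n / s * s) := mul_assoc ..
      _ ≤ c * n := Nat.mul_le_mul_left c (Nat.div_mul_le_self n s)
  unfold blockPos
  omega

/-- The row in which the value `v` of `σ` is placed. The extra block makes room for an upper element
`v` whose residue modulo `s` may be smaller than that of `lowBelow σ v`. -/
def boardRow (σ : Perm (Fin n)) (s v : ℕ) : ℕ :=
  blockPos s (2 * (v / s + lowBelow σ v / s) + if v / s = lowBelow σ v / s then 0 else 1) v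

/-- The column in which position `p` of `σ` is placed. -/
def boardCol (σ : Perm (Fin n)) (s : ℕ) (p : Fin n) : ℕ :=
  blockPos s (2 * (runMax σ p / s + lowMax σ p / s)) (lowMax σ p)

theorem boardRow_strictMono (hs : 0 < s) : StrictMono (boardRow σ s) := by
  intro v w hvw
  have hv : v / s ≤ w / s := Nat.div_le_div_right hvw.le
  have hlow : lowBelow σ v / s ≤ lowBelow σ w / s := Nat.div_le_div_right (lowBelow_mono σ hvw.le)
  rcases (add_le_add hv hlow).lt_or_eq with hlt | heq
  · exact blockPos_lt_blockPos hs (by split_ifs <;> omega) _ _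
  · have hv' : v / s = w / s := by omega
    have hlow' : lowBelow σ v / s = lowBelow σ w / s := by omega
    rw [boardRow, boardRow, hv', hlow']
    exact Nat.add_lt_add_left (mod_lt_mod_of_div_eq hvw hv') _

theorem boardCol_lt_or_eq (hs : 0 < s) {p q : Fin n} (hpq : p < q) :
    boardCol σ s p < boardCol σ s q ∨
      boardCol σ s p = boardCol σ s q ∧ lowMax σ p = lowMax σ q := by
  have hrun : runMax σ p / s ≤ runMax σ q / s := Nat.div_le_div_right (runMax_mono σ hpq.le)
  have hmono := lowMax_mono σ hpq.le
  have hlow : lowMax σ p / s ≤ lowMax σ q / s := Nat.div_le_div_right hmono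
  rcases (add_le_add hrun hlow).lt_or_eq with hlt | heq
  · exact Or.inl (blockPos_lt_blockPos hs (by omega) _ _)
  · have hrun' : runMax σ p / s = runMax σ q / s := by omega
    have hlow' : lowMax σ p / s = lowMax σ q / s := by omega
    rw [boardCol, boardCol, hrun', hlow']
    rcases hmono.lt_or_eq with hlt | heq
    · exact Or.inl (Nat.add_lt_add_left (mod_lt_mod_of_div_eq hlt hlow') _)
    · exact Or.inr ⟨by rw [heq], heq⟩

theorem boardRow_lt (hs : 0 < s) {v : ℕ} (hv : v ≤ n) : boardRow σ s v < 4 * n + s := by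
  have hdiv : v / s ≤ n / s := Nat.div_le_div_right hv
  have hlow : lowBelow σ v / s ≤ v / s := Nat.div_le_div_right (lowBelow_le v)
  exact blockPos_lt_of_le hs (by split_ifs <;> omega) v

theorem boardCol_lt (hs : 0 < s) (p : Fin n) : boardCol σ s p < 4 * n + s := by
  have hrun : runMax σ p / s ≤ n / s := Nat.div_le_div_right (maxValue_le_length _)
  have hlow : lowMax σ p / s ≤ n / s := Nat.div_le_div_right (maxValue_le_length _)
  exact blockPos_lt_of_le hs (by omega) _

theorem boardRow_mem_band (hs : 0 < s) {p : Fin n} (hp : ¬ IsLower σ p) :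
    boardCol σ s p ≤ boardRow σ s (σ p + 1) ∧
      boardRow σ s (σ p + 1) < boardCol σ s p + 2 * s := by
  have hle := lowMax_le_runMax (σ := σ) p
  have hlow := Nat.mod_lt (lowMax σ p) hs
  have hrun := Nat.mod_lt (runMax σ p) hs
  rw [boardRow, boardCol, lowBelow_eq hp, ← runMax_eq hp, blockPos, blockPos]
  split_ifs with h
  · have hmod : lowMax σ p % s ≤ runMax σ p % s := by
      rcases hle.lt_or_eq with hlt | heq
      · exact (mod_lt_mod_of_div_eq hlt h.symm).le
      · rw [heq]
    rw [add_zero]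
    omega
  · rw [add_mul]
    omega

theorem boardCol_mem_line (hσ : σ ∈ avoiders n perm321) {p : Fin n} (hp : IsLower σ p) :
    boardRow σ s (σ p + 1) ≤ boardCol σ s p ∧ s ∣ boardCol σ s p - boardRow σ s (σ p + 1) := by
  rw [boardRow, boardCol, lowMax_eq hσ hp, blockPos, blockPos]
  set v := (σ p : ℕ) + 1
  have hrun : v / s ≤ runMax σ p / s := Nat.div_le_div_right (le_runMax p)
  have hlow : lowBelow σ v / s ≤ v / s := Nat.div_le_div_right (lowBelow_le v)
  refine ⟨Nat.add_le_add_right (Nat.mul_le_mul_right s ?_) _, ?_⟩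
  · split_ifs <;> omega
  · rw [Nat.add_sub_add_right, ← Nat.sub_mul]
    exact dvd_mul_left s _

theorem isPlacement_board (hσ : σ ∈ avoiders n perm321) (hs : 0 < s) :
    IsPlacement σ fun p => (boardRow σ s (σ p + 1), boardCol σ s p) where
  strictMono_position := by
    intro p q hpq
    rw [Prod.Lex.toLex_lt_toLex]
    refine (boardCol_lt_or_eq hs hpq).imp_right fun ⟨hcol, hlow⟩ => ⟨hcol, ?_⟩
    have hq : ¬ IsLower σ q := fun hq => (lowMax_lt hσ hpq hq).ne hlow
    exact boardRow_strictMono hs (Nat.succ_lt_succ (lt_of_not_isLower hq hpq))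
  strictMono_value := by
    intro v w hvw
    rw [Prod.Lex.toLex_lt_toLex]
    exact Or.inl (boardRow_strictMono hs (by simpa using hvw))

end Embedding

section Board

variable {n N s : ℕ}

/-- The cells of the `N × N` board: the band from the diagonal downwards, and the
diagonal and every `s`-th diagonal line above it. -/
def boardCells (N s : ℕ) : Finset (Fin N × Fin N) :=
  {x | ((x.2 : ℕ) ≤ x.1 ∧ (x.1 : ℕ) ≤ x.2 + (2 * s + 1)) ∨
    ((x.1 : ℕ) ≤ x.2 ∧ s ∣ (x.2 : ℕ) - x.1)}

theorem mem_boardCells {i j : Fin N} :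
    (i, j) ∈ boardCells N s ↔ ((j : ℕ) ≤ i ∧ (i : ℕ) ≤ j + (2 * s + 1)) ∨
      ((i : ℕ) ≤ j ∧ s ∣ (j : ℕ) - i) :=
  mem_filter_univ (i, j)

theorem mem_boardCells_of_band {i j : Fin N} (hji : (j : ℕ) ≤ i) (hij : (i : ℕ) ≤ j + (2 * s + 1)) :
    (i, j) ∈ boardCells N s :=
  mem_boardCells.2 (Or.inl ⟨hji, hij⟩)

theorem mem_boardCells_of_add_eq {i j : Fin N} (h : (i : ℕ) + s = j) : (i, j) ∈ boardCells N s :=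
  mem_boardCells.2 (Or.inr ⟨by omega, by simp [← h]⟩)

theorem boardMatrix_eq (n : ℕ) : boardMatrix n = cellMatrix (boardCells (side n) (ceilSqrt n)) := by
  ext i j
  rw [boardMatrix, cellMatrix, Matrix.of_apply]
  refine if_congr ((or_congr ?_ ?_).trans mem_boardCells.symm) rfl rfl
  · omega
  · constructor
    · rintro ⟨k, -, hk⟩
      have hij : (j : ℕ) = i + k * ceilSqrt n := by
        zify
        linarith
      exact ⟨by omega, ⟨k, by rw [hij, Nat.add_sub_cancel_left, mul_comm]⟩⟩
    · rintro ⟨hij, hdvd⟩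
      refine ⟨(j - i) / ceilSqrt n, Nat.div_le_div_right (by omega), ?_⟩
      rw [← Nat.cast_mul, Nat.div_mul_cancel hdvd, Nat.cast_sub hij]

theorem columnsAreRuns_boardCells (hs : 0 < s) (hN : s < N) :
    ColumnsAreRuns (boardCells N s : Set (Fin N × Fin N)) := by
  refine ⟨fun j => ⟨j, mem_boardCells_of_band le_rfl (Nat.le_add_right _ _)⟩, fun j j' hj => ?_⟩
  have hj := Nat.covBy_iff_add_one_eq.1 (Fin.covBy_iff.1 hj)
  by_cases hlast : (j' : ℕ) + 1 < N
  · obtain ⟨i, hi⟩ : ∃ i : Fin N, (i : ℕ) = j' + 1 := ⟨⟨j' + 1, hlast⟩, rfl⟩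
    exact ⟨i, j', mem_boardCells_of_band (by omega) (by omega),
      mem_boardCells_of_band le_rfl (by omega), Fin.lt_def.2 (by omega)⟩
  · obtain ⟨i', hi'⟩ : ∃ i' : Fin N, (i' : ℕ) = j' - s := ⟨⟨j' - s, by omega⟩, rfl⟩
    exact ⟨j', i', mem_boardCells_of_band (by omega) (by omega),
      mem_boardCells_of_add_eq (by omega), Fin.lt_def.2 (by omega)⟩

theorem rowsAreRuns_boardCells (hs : 0 < s) (hN : s < N) :
    ColumnsAreRuns (Prod.swap ⁻¹' (boardCells N s : Set (Fin N × Fin N))) := by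
  suffices h : (∀ i, ∃ j, (i, j) ∈ boardCells N s) ∧ ∀ ⦃i i' : Fin N⦄, i ⋖ i' →
      ∃ j j', (i, j) ∈ boardCells N s ∧ (i', j') ∈ boardCells N s ∧ j' < j from h
  refine ⟨fun i => ⟨i, mem_boardCells_of_band le_rfl (Nat.le_add_right _ _)⟩, fun i i' hi => ?_⟩
  have hi := Nat.covBy_iff_add_one_eq.1 (Fin.covBy_iff.1 hi)
  by_cases hfirst : (i : ℕ) = 0
  · obtain ⟨j, hj⟩ : ∃ j : Fin N, (j : ℕ) = s := ⟨⟨s, hN⟩, rfl⟩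
    exact ⟨j, i, mem_boardCells_of_add_eq (by omega),
      mem_boardCells_of_band (by omega) (by omega), Fin.lt_def.2 (by omega)⟩
  · obtain ⟨j', hj'⟩ : ∃ j' : Fin N, (j' : ℕ) = i - 1 := ⟨⟨i - 1, by omega⟩, rfl⟩
    exact ⟨i, j', mem_boardCells_of_band le_rfl (by omega),
      mem_boardCells_of_band (by omega) (by omega), Fin.lt_def.2 (by omega)⟩

theorem isSuperpattern_of_isChessboard_boardCells (hs : 0 < s) (hN : 4 * n + s ≤ N) {m : ℕ}
    {μ : Perm (Fin m)} (hμ : IsChessboard μ (cellMatrix (boardCells N s))) :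
    IsSuperpattern μ (avoiders n perm321) := by
  intro σ hσ
  let cell (p : Fin n) : Fin N × Fin N :=
    (⟨boardRow σ s (σ p + 1), (boardRow_lt hs (σ p).2).trans_le hN⟩,
      ⟨boardCol σ s p, (boardCol_lt hs p).trans_le hN⟩)
  have hcell : IsPlacement σ cell :=
    (IsPlacement.map_iff Fin.val_strictMono Fin.val_strictMono).1 (isPlacement_board hσ hs)
  obtain ⟨cellμ, hcellμ, hrange⟩ := hμ.exists_isPlacement
  refine hcell.isPattern hcellμ (hrange ▸ ?_)
  rintro _ ⟨p, rfl⟩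
  refine mem_boardCells.2 ?_
  by_cases hp : IsLower σ p
  · exact Or.inr (boardCol_mem_line hσ hp)
  · have hband := boardRow_mem_band hs hp
    exact Or.inl ⟨hband.1, hband.2.le.trans (by dsimp only [cell]; omega)⟩

theorem ceilSqrt_pos (hn : 0 < n) : 0 < ceilSqrt n :=
  Nat.ceil_pos.2 (Real.sqrt_pos.2 (Nat.cast_pos.2 hn))

theorem existsUnique_isChessboard_boardMatrix (n : ℕ) :
    ∃! μ : (Σ m : ℕ, Perm (Fin m)), IsChessboard μ.2 (boardMatrix n) := by
  rw [boardMatrix_eq]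
  rcases n.eq_zero_or_pos with rfl | hn
  · have : IsEmpty (Fin (side 0)) := by
      rw [show side 0 = 0 by simp [side, ceilSqrt]]
      infer_instance
    exact existsUnique_isChessboard ⟨isEmptyElim, isEmptyElim⟩ ⟨isEmptyElim, isEmptyElim⟩
  · have hs := ceilSqrt_pos hn
    have hN : ceilSqrt n < side n := by unfold side; omega
    exact existsUnique_isChessboard (columnsAreRuns_boardCells hs hN)
      (rowsAreRuns_boardCells hs hN)

theorem isSuperpattern_of_isChessboard_boardMatrix {m : ℕ} {μ : Perm (Fin m)}
    (hμ : IsChessboard μ (boardMatrix n)) : IsSuperpattern μ (avoiders n perm321) := by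
  rcases n.eq_zero_or_pos with rfl | hn
  · exact fun σ _ => ⟨Fin.elim0, fun p => p.elim0, fun p => p.elim0⟩
  · rw [boardMatrix_eq] at hμ
    exact isSuperpattern_of_isChessboard_boardCells (ceilSqrt_pos hn)
      (by unfold side; omega) hμ

end Board

section Length

variable {n N s : ℕ}

theorem card_line_column (s j : ℕ) : #{i ∈ range j | s ∣ j - i} = j / s := by
  rw [← Nat.Ioc_filter_dvd_card_eq_div]
  refine card_nbij' (j - ·) (j - ·) ?_ ?_ ?_ ?_ <;>
    simp only [Set.MapsTo, Set.LeftInvOn, coe_filter, mem_range, mem_Ioc, Set.mem_ofPred_eq] <;>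
    rintro i ⟨hi, hdvd⟩
  · exact ⟨by omega, hdvd⟩
  · exact ⟨by omega, by rwa [Nat.sub_sub_self hi.2]⟩
  · exact Nat.sub_sub_self hi.le
  · exact Nat.sub_sub_self hi.2

theorem card_board_column {j : ℕ} (hj : j < N) :
    #{i ∈ range N | (j ≤ i ∧ i ≤ j + (2 * s + 1)) ∨ (i ≤ j ∧ s ∣ j - i)} =
      min (N - j) (2 * s + 2) + j / s := by
  have hsplit : {i ∈ range N | (j ≤ i ∧ i ≤ j + (2 * s + 1)) ∨ (i ≤ j ∧ s ∣ j - i)} =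
      Ico j (min N (j + (2 * s + 2))) ∪ {i ∈ range j | s ∣ j - i} := by
    ext i
    simp only [mem_filter, mem_range, mem_union, mem_Ico]
    rcases lt_or_ge i j with hij | hij
    · simp only [hij, hij.trans hj, hij.le, hij.not_ge, false_and, false_or, true_and]
    · omega
  have hdisj : Disjoint (Ico j (min N (j + (2 * s + 2)))) {i ∈ range j | s ∣ j - i} := by
    simp only [disjoint_left, mem_filter, mem_range, mem_Ico]
    omega
  rw [hsplit, card_union_of_disjoint hdisj, card_line_column, Nat.card_Ico]
  omega

theorem card_boardCells (N s : ℕ) :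
    #(boardCells N s) = ∑ j ∈ range N, min (N - j) (2 * s + 2) + ∑ j ∈ range N, j / s := by
  rw [boardCells, card_filter, Fintype.sum_prod_type_right, ← sum_add_distrib]
  dsimp only
  rw [Fin.sum_univ_eq_sum_range (fun j => ∑ i : Fin N, if (j ≤ i ∧ i ≤ j + (2 * s + 1)) ∨
    (i ≤ j ∧ s ∣ j - i) then 1 else 0)]
  refine sum_congr rfl fun j hj => ?_
  rw [← card_board_column (mem_range.1 hj), card_filter]
  exact Fin.sum_univ_eq_sum_range (fun i => if (j ≤ i ∧ i ≤ j + (2 * s + 1)) ∨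
    (i ≤ j ∧ s ∣ j - i) then 1 else 0) N

theorem sum_min_le (N b : ℕ) : ∑ j ∈ range N, min (N - j) b ≤ N * b := by
  simpa using sum_le_card_nsmul (range N) _ b fun j _ => min_le_right (N - j) b

theorem le_sum_min (N b : ℕ) : (N - b) * b ≤ ∑ j ∈ range N, min (N - j) b :=
  calc (N - b) * b = ∑ _j ∈ range (N - b), b := by simp
    _ ≤ ∑ j ∈ range (N - b), min (N - j) b := sum_le_sum fun j hj => by
        rw [mem_range] at hj
        omega
    _ ≤ ∑ j ∈ range N, min (N - j) b :=
        sum_le_sum_of_subset (range_subset_range.2 (Nat.sub_le N b))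

theorem sum_div_le (N s : ℕ) : 2 * s * ∑ j ∈ range N, j / s ≤ N * (N - 1) := by
  rw [mul_assoc, mul_comm 2, ← sum_range_id_mul_two, mul_sum]
  exact Nat.mul_le_mul_right 2 (sum_le_sum fun j _ => Nat.mul_div_le j s)

theorem le_sum_div (N : ℕ) (hs : 0 < s) :
    N * (N - 1) ≤ 2 * s * ∑ j ∈ range N, j / s + 2 * N * s := by
  have hle : ∑ j ∈ range N, j ≤ ∑ j ∈ range N, (s * (j / s) + s) :=
    sum_le_sum fun j _ => (Nat.lt_mul_div_succ j hs).le
  rw [sum_add_distrib, ← mul_sum, sum_const, card_range, smul_eq_mul] at hle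
  rw [← sum_range_id_mul_two]
  linarith

theorem cubic_bounds {r s : ℝ} (hr : 1 ≤ r) (hrs : r ≤ s) (hsr : s ≤ r + 1) {N : ℝ}
    (hN : N = 6 * r ^ 2 + 8 * s) :
    30 * r ^ 3 + 42 * r ^ 2 ≤ (N - (2 * s + 2)) * (2 * s + 2) + (N ^ 2 / (2 * s) - 2 * N) ∧
      N * (2 * s + 2) + N ^ 2 / (2 * s) ≤ 30 * r ^ 3 + 232 * r ^ 2 := by
  have hs : 0 < s := by linarith
  have hexpand : N ^ 2 / (2 * s) = 18 * (r ^ 4 / s) + 48 * r ^ 2 + 32 * s := by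
    rw [hN]
    field_simp
    ring
  have hquot_le : r ^ 4 / s ≤ r ^ 3 := by
    rw [div_le_iff₀ hs, pow_succ r 3]
    gcongr
  have hle_quot : r ^ 2 * (2 * r - s) ≤ r ^ 4 / s := by
    rw [le_div_iff₀ hs]
    nlinarith [mul_nonneg (sq_nonneg r) (sq_nonneg (r - s))]
  have hr2 : r ≤ r ^ 2 := by nlinarith
  have hr2s : r ^ 2 * s ≤ r ^ 2 * (r + 1) := by gcongr
  have hs2 : s ^ 2 ≤ (r + 1) ^ 2 := by gcongr
  rw [hexpand, hN]
  constructor <;> nlinarith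

theorem card_boardCells_bounds (N : ℕ) (hs : 0 < s) :
    ((N : ℝ) - (2 * s + 2)) * (2 * s + 2) + ((N : ℝ) ^ 2 / (2 * s) - 2 * N) ≤
        #(boardCells N s) ∧
      (#(boardCells N s) : ℝ) ≤ N * (2 * s + 2) + (N : ℝ) ^ 2 / (2 * s) := by
  have hs' : (1 : ℝ) ≤ s := by exact_mod_cast hs
  have hband_le : ((∑ j ∈ range N, min (N - j) (2 * s + 2) : ℕ) : ℝ) ≤ N * (2 * s + 2) := by
    exact_mod_cast sum_min_le N (2 * s + 2)
  have hle_band : ((N : ℝ) - (2 * s + 2)) * (2 * s + 2) ≤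
      (∑ j ∈ range N, min (N - j) (2 * s + 2) : ℕ) := by
    have hcast : ((N : ℝ) - (2 * s + 2)) ≤ (N - (2 * s + 2) : ℕ) := by
      rw [sub_le_iff_le_add]
      exact_mod_cast le_tsub_add
    calc ((N : ℝ) - (2 * s + 2)) * (2 * s + 2) ≤ (N - (2 * s + 2) : ℕ) * (2 * s + 2) := by gcongr
      _ ≤ _ := by exact_mod_cast le_sum_min N (2 * s + 2)
  have hline_le : ((∑ j ∈ range N, j / s : ℕ) : ℝ) ≤ (N : ℝ) ^ 2 / (2 * s) := by
    rw [le_div_iff₀' (by positivity), sq]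
    exact_mod_cast (sum_div_le N s).trans (Nat.mul_le_mul_left N (Nat.sub_le N 1))
  have hle_line : (N : ℝ) ^ 2 / (2 * s) - 2 * N ≤ (∑ j ∈ range N, j / s : ℕ) := by
    have hnat : N * N ≤ 2 * s * ∑ j ∈ range N, j / s + 2 * N * s + N := by
      have h := le_sum_div N hs
      rw [Nat.mul_sub_one] at h
      omega
    have hreal : (N : ℝ) * N ≤ 2 * s * (∑ j ∈ range N, j / s : ℕ) + 2 * N * s + N := by
      exact_mod_cast hnat
    rw [sub_le_iff_le_add, div_le_iff₀ (by positivity)]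
    nlinarith [N.cast_nonneg (α := ℝ)]
  rw [card_boardCells, Nat.cast_add]
  exact ⟨add_le_add hle_band hle_line, add_le_add hband_le hline_le⟩

theorem length_bounds_of_isChessboard {m : ℕ} (hn : 0 < n) {μ : Perm (Fin m)}
    (hμ : IsChessboard μ (boardMatrix n)) :
    42 * (n : ℝ) ≤ m - 30 * (n : ℝ) ^ (3 / 2 : ℝ) ∧
      m - 30 * (n : ℝ) ^ (3 / 2 : ℝ) ≤ 232 * n := by
  rw [boardMatrix_eq] at hμ
  have hsq : √(n : ℝ) ^ 2 = n := Real.sq_sqrt n.cast_nonneg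
  have hcube : (n : ℝ) ^ (3 / 2 : ℝ) = √(n : ℝ) ^ 3 := by
    rw [Real.sqrt_eq_rpow, ← Real.rpow_mul_natCast n.cast_nonneg]
    norm_num
  have hside : (side n : ℝ) = 6 * √(n : ℝ) ^ 2 + 8 * ceilSqrt n := by
    rw [hsq, side]
    push_cast
    rfl
  obtain ⟨hlow, hup⟩ := card_boardCells_bounds (side n) (ceilSqrt_pos hn)
  obtain ⟨hlow', hup'⟩ := cubic_bounds (s := ceilSqrt n)
    (Real.one_le_sqrt.2 (Nat.one_le_cast.2 hn)) (Nat.le_ceil _)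
    (Nat.ceil_lt_add_one (Real.sqrt_nonneg _)).le hside
  rw [hμ.card_eq] at hlow hup
  rw [hsq] at hlow' hup'
  rw [hcube]
  constructor <;> linarith

end Length

end Superpattern

theorem theorem3p4 :
    -- the matrix `M_n` is the chessboard representation of exactly one permutation `μ_n`
    (∀ n : ℕ, ∃! μ : (Σ m : ℕ, Equiv.Perm (Fin m)),
      Superpattern.IsChessboard μ.2 (Superpattern.boardMatrix n)) ∧
    -- `μ_n` is an `S_n(321)`-superpattern, and so is its inverse (rows and columns exchanged)
    (∀ (n m : ℕ) (μ : Equiv.Perm (Fin m)),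
      Superpattern.IsChessboard μ (Superpattern.boardMatrix n) →
        Superpattern.IsSuperpattern μ (Superpattern.avoiders n Superpattern.perm321) ∧
        Superpattern.IsSuperpattern μ⁻¹ (Superpattern.avoiders n Superpattern.perm321)) ∧
    -- the length of `μ_n` is `30 n ^ (3/2) + Θ(n)`
    (∃ c C : ℝ, 0 < c ∧ 0 < C ∧ ∃ n₀ : ℕ, ∀ n : ℕ, n₀ ≤ n →
      ∀ (m : ℕ) (μ : Equiv.Perm (Fin m)),
        Superpattern.IsChessboard μ (Superpattern.boardMatrix n) →
          c * (n : ℝ) ≤ (m : ℝ) - 30 * (n : ℝ) ^ (3 / 2 : ℝ) ∧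
          (m : ℝ) - 30 * (n : ℝ) ^ (3 / 2 : ℝ) ≤ C * (n : ℝ)) := by
  refine ⟨Superpattern.existsUnique_isChessboard_boardMatrix, fun n m μ hμ => ?_,
    42, 232, by norm_num, by norm_num, 1,
    fun n hn m μ hμ => Superpattern.length_bounds_of_isChessboard hn hμ⟩
  have h := Superpattern.isSuperpattern_of_isChessboard_boardMatrix hμ
  refine ⟨h, ?_⟩
  simpa only [Superpattern.inv_avoiders, Superpattern.perm321_inv] using h.inv
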